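/- Let $L$ be the $2$-ladder, i.e. the graph with vertex set $\{1,2,3,a,b,c,d\}$ and edge set $\{12,\,1a,\,ab,\,b3,\,2c,\,cd,\,d3,\,ac,\,bd\}$. Let $G$ be a simple graph which contains $L$ as an induced subgraph in such a way that none of the vertices $a,b,c,d$ has a neighbour in $G$ outside $L$ (the vertices $1,2,3$ may have further neighbours). Then the independence complex $\mathrm{Ind}(G)$, i.e. (the geometric realization of) the simplicial complex whose simplices are the finite independent sets of vertices of $G$, has the homotopy type of a suspension: there is a topological space $X$ such that $\mathrm{Ind}(G)\simeq\Sigma X$, where $\Sigma$ is the unreduced suspension. -/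

import Mathlib

universe u

/-- The independence complex of `G`: its (nonempty) simplices are the nonempty finite independent
sets of vertices of `G`. -/
def SimpleGraph.indComplex {V : Type u} (G : SimpleGraph V) : PreAbstractSimplicialComplex V where
  faces := {s : Finset V | s.Nonempty ∧ G.IsIndepSet (s : Set V)}
  isRelLowerSet_faces := fun _ hs =>
    ⟨hs.1, fun _ hts ht => ⟨ht, hs.2.mono (Finset.coe_subset.2 hts)⟩⟩

namespace PreAbstractSimplicialComplex

/-- The points of the geometric realization `|K|`, in barycentric coordinates: functions `x ≥ 0` on
the vertices which vanish off some simplex of `K` and whose values on it sum to `1`. -/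
def Realization {V : Type u} (K : PreAbstractSimplicialComplex V) : Type u :=
  {x : V → ℝ // (∀ v, 0 ≤ x v) ∧ ∃ s ∈ K.faces, (∀ v, v ∉ s → x v = 0) ∧ ∑ v ∈ s, x v = 1}

/-- The barycentric coordinates of a point of `|K|`. -/
def Realization.coord {V : Type u} {K : PreAbstractSimplicialComplex V} (x : K.Realization) :
    V → ℝ :=
  x.1

/-- The closed geometric simplex in `|K|` spanned by a simplex `s`. -/
def closedSimplex {V : Type u} (K : PreAbstractSimplicialComplex V) (s : Finset V) :
    Set K.Realization :=
  {x | ∀ v, v ∉ s → x.coord v = 0}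

/-- The Euclidean topology on a closed geometric simplex, given by its barycentric coordinates. -/
abbrev closedSimplexTopology {V : Type u} (K : PreAbstractSimplicialComplex V) (s : Finset V) :
    TopologicalSpace (K.closedSimplex s) :=
  TopologicalSpace.induced (fun x => x.1.coord) Pi.topologicalSpace

/-- The topology of `|K|`, coherent with its closed simplices: a set is open (closed) if and only
if its trace on every closed simplex is open (closed) in the Euclidean topology. -/
instance {V : Type u} (K : PreAbstractSimplicialComplex V) : TopologicalSpace K.Realization :=
  ⨆ s : K.faces, TopologicalSpace.coinduced Subtype.val (K.closedSimplexTopology s.1)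

end PreAbstractSimplicialComplex

/-- The generating relation of the suspension: the bottom `X × {0}` of the cylinder is glued to
one pole, and the top `X × {1}` to the other. -/
inductive SuspensionRel (X : Type u) : (X × unitInterval) ⊕ Bool → (X × unitInterval) ⊕ Bool → Prop
  | bottom (x : X) : SuspensionRel X (Sum.inl (x, 0)) (Sum.inr false)
  | top (x : X) : SuspensionRel X (Sum.inl (x, 1)) (Sum.inr true)

/-- The (unreduced) suspension of `X`: the cylinder `X × [0, 1]` together with two poles, its
bottom and its top being collapsed to the respective pole. -/
def Suspension (X : Type u) : Type u :=
  Quot (SuspensionRel X)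

instance (X : Type u) [TopologicalSpace X] : TopologicalSpace (Suspension X) :=
  inferInstanceAs (TopologicalSpace (Quot (SuspensionRel X)))

/-- The seven vertices `1, 2, 3, a, b, c, d` of the `2`-ladder. -/
inductive LadderVertex : Type
  | v1 | v2 | v3 | a | b | c | d

open LadderVertex in
/-- The `2`-ladder: rails `1 - a - b - 3` and `2 - c - d - 3` which meet in the vertex `3`, and
rungs `12`, `ac` and `bd`. -/
def twoLadder : SimpleGraph LadderVertex :=
  SimpleGraph.fromEdgeSet
    {s(v1, v2), s(v1, a), s(a, b), s(b, v3), s(v2, c), s(c, d), s(d, v3), s(a, c), s(b, d)}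

/-! The neighbours of `a` in `G` are `1`, `b`, `c`, and no two of these are adjacent. Write `N` for
this set and let `mass N` be the total barycentric weight of a point on `N`, a continuous function
on the realization.

Where `mass N < 1`, the coordinates in `N` can be dropped and the rest rescaled. This retracts the
open set onto the independence complex of `G - N`, a cone with apex `a`. Where `0 < mass N`, the
other coordinates can be dropped, which retracts onto the full simplex on the independent set `N`.
Both open sets are therefore contractible (`contractibleSpace_of_restrict`), and they cover the
complex.

A space covered by contractible open sets `{f < 1}` and `{0 < f}` is equivalent to the suspension of
their intersection (`Suspension.nonempty_homotopyEquiv`): `f`, rescaled, supplies the height, and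
the two contractions collapse the ends of the cylinder. -/

open Topology Filter unitInterval

/-! ### Suspensions: maps out of them and changes of height -/

namespace Suspension

/-- The two poles of the suspension: `false` is the bottom, `true` the top. -/
def pole {X : Type u} (b : Bool) : Suspension X := Quot.mk _ (Sum.inr b)

/-- The point of the suspension at height `t` over `x`. -/
def point {X : Type u} (x : X) (t : I) : Suspension X := Quot.mk _ (Sum.inl (x, t))

theorem point_zero {X : Type u} (x : X) : point x 0 = pole false :=
  Quot.sound (SuspensionRel.bottom x)

theorem point_one {X : Type u} (x : X) : point x 1 = pole true :=
  Quot.sound (SuspensionRel.top x)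

theorem ind {X : Type u} {P : Suspension X → Prop} (h₁ : ∀ x t, P (point x t))
    (h₂ : ∀ b, P (pole b)) (p : Suspension X) : P p := by
  induction p using Quot.ind with
  | mk q =>
    rcases q with ⟨x, t⟩ | b
    exacts [h₁ x t, h₂ b]

/-- Maps out of a suspension are given by maps out of the cylinder that are constant on its bottom
and on its top. -/
def lift {X Y : Type*} (F : X × I → Y) (q : Bool → Y) (h₀ : ∀ x, F (x, 0) = q false)
    (h₁ : ∀ x, F (x, 1) = q true) : Suspension X → Y :=
  Quot.lift (Sum.elim F q) (by
    rintro _ _ (x | x)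
    exacts [h₀ x, h₁ x])

/-- The height of a point of the suspension. -/
def height {X : Type*} : Suspension X → I :=
  lift Prod.snd (fun b => if b then 1 else 0) (by simp) (by simp)

@[simp] theorem height_point {X : Type*} (x : X) (t : I) : height (point x t) = t := rfl

@[simp] theorem height_pole {X : Type*} (b : Bool) :
    height (X := X) (pole b) = if b then 1 else 0 := rfl

variable {X Y : Type*} [TopologicalSpace X] [TopologicalSpace Y]

theorem continuous_point : Continuous fun z : X × I => point z.1 z.2 :=
  continuous_quot_mk.comp continuous_inl

theorem continuous_lift {F : X × I → Y} {q : Bool → Y} {h₀ : ∀ x, F (x, 0) = q false}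
    {h₁ : ∀ x, F (x, 1) = q true} (hF : Continuous F) : Continuous (lift F q h₀ h₁) :=
  continuous_quot_lift _ (hF.sumElim continuous_of_discreteTopology)

theorem continuous_height : Continuous (height (X := X)) := continuous_lift continuous_snd

/-- Reparametrizing the heights in a suspension does not change the homotopy class of a self-map,
as long as the ends stay fixed. -/
theorem homotopic_id_of_reparam (φ : C(I, I)) (φ₀ : φ 0 = 0) (φ₁ : φ 1 = 1)
    (r : C(Suspension X, Suspension X)) (hr : ∀ x t, r (point x t) = point x (φ t))
    (hp : ∀ b, r (pole b) = pole b) : r.Homotopic (ContinuousMap.id _) := by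
  let w : I → I → I := fun t s => Set.projIcc 0 1 zero_le_one
    ((1 - (s : ℝ)) * φ t + s * t)
  have hw : Continuous fun z : I × I => w z.1 z.2 :=
    continuous_projIcc.comp (by fun_prop)
  -- Currying the time variable lets the homotopy descend to the quotient without a product of a
  -- quotient map with `I`.
  let Φ : C(X × I, C(I, Suspension X)) := ContinuousMap.curry
    ⟨fun z => point z.1.1 (w z.1.2 z.2), 
      continuous_point.comp ((continuous_fst.comp continuous_fst).prodMk
        (hw.comp ((continuous_snd.comp continuous_fst).prodMk continuous_snd)))⟩
  let F : Suspension X → C(I, Suspension X) :=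
    lift Φ (fun b => ContinuousMap.const _ (pole b))
      (fun x => by
        ext s
        simp [Φ, w, φ₀, ← point_zero x])
      (fun x => by
        ext s
        simp [Φ, w, φ₁, ← point_one x])
  have hF : Continuous F := continuous_lift Φ.continuous
  refine ⟨⟨⟨fun z => F z.2 z.1, ?_⟩, ?_, ?_⟩⟩
  · exact (ContinuousMap.continuous_uncurry_of_continuous ⟨F, hF⟩).comp continuous_swap
  · intro p
    induction p using ind with
    | h₁ x t =>
      rw [hr]
      change point x (w t 0) = _
      simp [w]
    | h₂ b => rw [hp]; rfl
  · intro p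
    induction p using ind with
    | h₁ x t =>
      change point x (w t 1) = _
      simp [w]
    | h₂ b => rfl

end Suspension

/-- A contractible subset contracts to one of its points, within itself. -/
theorem exists_contraction {K : Type*} [TopologicalSpace K] (U : Set K) [ContractibleSpace U] :
    ∃ (c : I × K → K) (p : K), p ∈ U ∧ ContinuousOn c {z | z.2 ∈ U} ∧
      ∀ y ∈ U, c (0, y) = y ∧ c (1, y) = p ∧ ∀ s, c (s, y) ∈ U := by
  classical
  obtain ⟨p, ⟨H⟩⟩ := id_nullhomotopic U
  refine ⟨fun z => if h : z.2 ∈ U then H (z.1, ⟨z.2, h⟩) else z.2, p, p.2, ?_, ?_⟩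
  · rw [continuousOn_iff_continuous_domRestrict]
    have : Continuous fun z : {z : I × K | z.2 ∈ U} => (H (z.1.1, ⟨z.1.2, z.2⟩) : K) := by
      fun_prop
    convert this using 2 with z
    have hz : z.1.2 ∈ U := z.2
    simp [hz]
  · intro y hy
    simp [hy]

/-! ### Spaces covered by two contractible open sets -/

namespace Suspension

variable {K : Type u} (f : K → ℝ)

open Classical in
/-- The point of the suspension of `{y | 0 < f y < 1}` at height `s` over `y`, where the points with
`f y ≤ 0` lie at the bottom and those with `1 ≤ f y` at the top. -/
noncomputable def cylinderPoint (z : K × I) : Suspension {y : K // 0 < f y ∧ f y < 1} :=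
  if h : 0 < f z.1 ∧ f z.1 < 1 then point ⟨z.1, h⟩ z.2 else pole (decide (¬ f z.1 ≤ 0))

variable {f}

theorem cylinderPoint_of_mem {y : K} (h : 0 < f y ∧ f y < 1) (s : I) :
    cylinderPoint f (y, s) = point ⟨y, h⟩ s := by
  rw [cylinderPoint, dif_pos h]

theorem cylinderPoint_zero {y : K} (h : f y < 1) : cylinderPoint f (y, 0) = pole false := by
  by_cases h' : 0 < f y
  · rw [cylinderPoint_of_mem ⟨h', h⟩, point_zero]
  · rw [cylinderPoint, dif_neg (by simp [h'])]
    simp [not_lt.1 h']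

theorem cylinderPoint_one {y : K} (h : 0 < f y) : cylinderPoint f (y, 1) = pole true := by
  by_cases h' : f y < 1
  · rw [cylinderPoint_of_mem ⟨h, h'⟩, point_one]
  · rw [cylinderPoint, dif_neg (by simp [h'])]
    simp [h]

theorem continuousAt_cylinderPoint [TopologicalSpace K] (hf : Continuous f) {y : K} (h : 0 < f y ∧ f y < 1) (s : I) :
    ContinuousAt (cylinderPoint f) (y, s) := by
  let e : {y : K // 0 < f y ∧ f y < 1} × I → K × I := fun z => (z.1.1, z.2)
  have he : IsOpenEmbedding e :=
    (((isOpen_Ioo (a := (0 : ℝ)) (b := 1)).preimage hf).isOpenEmbedding_subtypeVal).prodMap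
      IsOpenEmbedding.id
  refine (he.continuousAt_iff (x := (⟨y, h⟩, s))).1 ?_
  have : cylinderPoint f ∘ e = fun z => point z.1 z.2 := by
    ext z
    exact cylinderPoint_of_mem z.1.2 z.2
  rw [this]
  exact continuous_point.continuousAt

/-- Where `f` reaches 0 or 1 the base point leaves the equator. Continuity survives there if the
height is already locally constant at an end, since the value is then locally a fixed pole. -/
theorem continuous_cylinderPoint [TopologicalSpace K] (hf : Continuous f) {Z : Type*}
    [TopologicalSpace Z] {y : Z → K} {s : Z → I} (hy : Continuous y) (hs : Continuous s)
    (H : ∀ z, (0 < f (y z) ∧ f (y z) < 1) ∨ (∀ᶠ z' in 𝓝 z, f (y z') < 1 ∧ s z' = 0) ∨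
      (∀ᶠ z' in 𝓝 z, 0 < f (y z') ∧ s z' = 1)) :
    Continuous fun z => cylinderPoint f (y z, s z) := by
  rw [continuous_iff_continuousAt]
  intro z
  rcases H z with H | H | H
  · exact ContinuousAt.comp (f := fun z => (y z, s z)) (continuousAt_cylinderPoint hf H (s z))
      (hy.prodMk hs).continuousAt
  · refine (continuousAt_const (y := pole false)).congr ?_
    filter_upwards [H] with z' hz'
    rw [hz'.2, cylinderPoint_zero hz'.1]
  · refine (continuousAt_const (y := pole true)).congr ?_
    filter_upwards [H] with z' hz'
    rw [hz'.2, cylinderPoint_one hz'.1]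

/-- A space covered by two contractible open sets `{f < 1}` and `{0 < f}`, where `f` is a continuous
function, is homotopy equivalent to the suspension of their intersection. -/
theorem nonempty_homotopyEquiv [TopologicalSpace K] (hf : Continuous f)
    [ContractibleSpace {y | f y < 1}] [ContractibleSpace {y | 0 < f y}] :
    Nonempty (ContinuousMap.HomotopyEquiv K (Suspension {y : K // 0 < f y ∧ f y < 1})) := by
  obtain ⟨c₀, p₀, hp₀, hc₀, H₀⟩ := exists_contraction {y | f y < 1}
  obtain ⟨c₁, p₁, hp₁, hc₁, H₁⟩ := exists_contraction {y | 0 < f y}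
  simp only [Set.mem_ofPred_eq] at *
  let clamp : ℝ → I := Set.projIcc 0 1 zero_le_one
  have hclamp : Continuous clamp := continuous_projIcc
  have clamp_zero : ∀ r ≤ 0, clamp r = 0 := fun r hr => Set.projIcc_of_le_left _ hr
  have clamp_one : ∀ r, 1 ≤ r → clamp r = 1 := fun r hr => Set.projIcc_of_right_le _ hr
  have clamp_coe : ∀ t : I, clamp t = t := fun t => Set.projIcc_val _ t
  -- `φ` is 0 up to 1/3 and 1 from 2/3 on, so heights are constant near the places where `f` is 0 or
  -- 1.
  let φ : ℝ → I := fun r => clamp (3 * r - 1)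
  have hφ : Continuous φ := hclamp.comp (by fun_prop)
  have φ_half : ∀ r, (φ r : ℝ) ≤ 1 / 2 ↔ r ≤ 1 / 2 := by
    intro r
    simp only [φ, clamp, Set.coe_projIcc]
    rcases le_total (3 * r - 1) 1 with h | h
    · rw [min_eq_right h, max_le_iff]
      constructor
      · intro h'; linarith [h'.2]
      · intro h'; constructor <;> linarith
    · rw [min_eq_left h]
      constructor
      · intro h'; norm_num at h'
      · intro h'; linarith
  -- the contraction `c₀` on the lower half of the cylinder, `c₁` on its upper half
  let C : I → I × K → K := fun u z => if (z.1 : ℝ) ≤ 1 / 2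
    then c₀ (clamp (u * clamp (1 - 3 * z.1)), z.2) else c₁ (clamp (u * clamp (3 * z.1 - 2)), z.2)
  -- Both contraction parameters vanish for heights in the middle third, so the two branches agree
  -- at height 1/2.
  have hC : ContinuousOn (fun w : I × I × K => C w.1 w.2)
      {w | ((w.2.1 : ℝ) ≤ 1 / 2 → f w.2.2 < 1) ∧ (1 / 2 ≤ (w.2.1 : ℝ) → 0 < f w.2.2)} := by
    rw [continuousOn_iff_continuous_domRestrict]
    refine continuous_if_le (by fun_prop) continuous_const ?_ ?_ ?_
    · refine hc₀.comp (Continuous.continuousOn ?_) fun w hw => w.2.1 hw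
      exact (hclamp.comp (by fun_prop)).prodMk (by fun_prop)
    · refine hc₁.comp (Continuous.continuousOn ?_) fun w hw => w.2.2 hw
      exact (hclamp.comp (by fun_prop)).prodMk (by fun_prop)
    · intro w hw
      rw [clamp_zero (1 - 3 * (w.1.2.1 : ℝ)) (by linarith),
        clamp_zero (3 * (w.1.2.1 : ℝ) - 2) (by linarith)]
      simp only [Set.Icc.coe_zero, mul_zero]
      rw [clamp_zero _ le_rfl, (H₀ _ (w.2.1 hw.le)).1, (H₁ _ (w.2.2 hw.ge)).1]
  have C_zero : ∀ (t : I) y, ((t : ℝ) ≤ 1 / 2 → f y < 1) → (1 / 2 ≤ (t : ℝ) → 0 < f y) →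
      C 0 (t, y) = y := by
    intro t y h₀ h₁
    simp only [C, Set.Icc.coe_zero, zero_mul]
    rw [clamp_zero _ le_rfl]
    split_ifs with h
    exacts [(H₀ y (h₀ h)).1, (H₁ y (h₁ (not_le.1 h).le)).1]
  have C_bot : ∀ y, f y < 1 → C 1 (0, y) = p₀ := by
    intro y hy
    have : clamp (1 - 3 * ((0 : I) : ℝ)) = 1 := clamp_one _ (by simp)
    change (if ((0 : I) : ℝ) ≤ 1 / 2 then _ else _) = _
    rw [if_pos (by norm_num)]
    simp only [this, Set.Icc.coe_one, mul_one]
    rw [clamp_one _ le_rfl, (H₀ y hy).2.1]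
  have C_top : ∀ y, 0 < f y → C 1 (1, y) = p₁ := by
    intro y hy
    have : clamp (3 * ((1 : I) : ℝ) - 2) = 1 := clamp_one _ (by norm_num)
    change (if ((1 : I) : ℝ) ≤ 1 / 2 then _ else c₁ (clamp (((1 : I) : ℝ) *
      clamp (3 * ((1 : I) : ℝ) - 2)), y)) = _
    rw [if_neg (by norm_num), this, Set.Icc.coe_one, mul_one, clamp_one _ le_rfl, (H₁ y hy).2.1]
  -- At `u = 1` both contractions are complete at the ends of the cylinder, so each end goes to a
  -- single point and the map descends.
  let h : Suspension {y : K // 0 < f y ∧ f y < 1} → K :=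
    lift (fun z => C 1 (z.2, z.1)) (fun b => if b then p₁ else p₀)
      (fun x => C_bot _ x.2.2) (fun x => C_top _ x.2.1)
  have hh : Continuous h := continuous_lift
    (hC.comp_continuous (f := fun z : {y : K // 0 < f y ∧ f y < 1} × I => ((1 : I), z.2, z.1.1))
      (by fun_prop) fun z => ⟨fun _ => z.1.2.2, fun _ => z.1.2.1⟩)
  have h_lt : ∀ p, (height p : ℝ) ≤ 1 / 2 → f (h p) < 1 := by
    intro p hp
    induction p using ind with
    | h₁ x t =>
      change f (C 1 (t, x)) < 1
      rw [height_point] at hp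
      simp only [C, if_pos hp]
      exact (H₀ x x.2.2).2.2 _
    | h₂ b =>
      cases b
      · exact hp₀
      · norm_num at hp
  have h_pos : ∀ p, 1 / 2 < (height p : ℝ) → 0 < f (h p) := by
    intro p hp
    induction p using ind with
    | h₁ x t =>
      change 0 < f (C 1 (t, x))
      rw [height_point] at hp
      simp only [C, if_neg hp.not_ge]
      exact (H₁ x x.2.1).2.2 _
    | h₂ b =>
      cases b
      · norm_num at hp
      · exact hp₁
  have h_mid : ∀ (x : {y : K // 0 < f y ∧ f y < 1}) (t : I), 1 / 3 ≤ (t : ℝ) → (t : ℝ) ≤ 2 / 3 →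
      h (point x t) = x := by
    intro x t ht₀ ht₁
    change C 1 (t, x) = x
    simp only [C]
    rw [clamp_zero (1 - 3 * (t : ℝ)) (by linarith), clamp_zero (3 * (t : ℝ) - 2) (by linarith)]
    simp only [Set.Icc.coe_zero, mul_zero]
    rw [clamp_zero _ le_rfl, (H₀ _ x.2.2).1, (H₁ _ x.2.1).1, ite_self]
  have hm : ∀ p, 1 / 3 ≤ (height p : ℝ) → (height p : ℝ) ≤ 2 / 3 → 0 < f (h p) ∧ f (h p) < 1 := by
    intro p hp₀ hp₁
    induction p using ind with
    | h₁ x t =>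
      rw [h_mid x t hp₀ hp₁]
      exact x.2
    | h₂ b =>
      cases b
      · norm_num at hp₀
      · norm_num at hp₁
  let g : K → Suspension {y : K // 0 < f y ∧ f y < 1} := fun y => cylinderPoint f (y, φ (f y))
  have hφ₀ : ∀ r ≤ 1 / 3, φ r = 0 := fun r hr => clamp_zero _ (by linarith)
  have hφ₁ : ∀ r, 2 / 3 ≤ r → φ r = 1 := fun r hr => clamp_one _ (by linarith)
  have hg : Continuous g := by
    refine continuous_cylinderPoint hf continuous_id (hφ.comp hf) fun y => ?_
    rcases le_or_gt (f y) 0 with h' | h'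
    · right; left
      filter_upwards [hf.continuousAt.eventually_lt_const (show f y < 1 / 3 by linarith)] with z hz
      exact ⟨show f z < 1 by linarith, hφ₀ _ hz.le⟩
    · rcases lt_or_ge (f y) 1 with h'' | h''
      · exact Or.inl ⟨h', h''⟩
      · right; right
        filter_upwards [hf.continuousAt.eventually_const_lt (show 2 / 3 < f y by linarith)] with z hz
        exact ⟨show 0 < f z by linarith, hφ₁ _ hz.le⟩
  have g_apply : ∀ y, h (g y) = C 1 (φ (f y), y) := by
    intro y
    by_cases hy : 0 < f y ∧ f y < 1
    · simp only [g]
      rw [cylinderPoint_of_mem hy]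
      rfl
    · rcases le_or_gt (f y) 0 with h' | h'
      · simp only [g]
        rw [hφ₀ _ (by linarith), cylinderPoint_zero (by linarith), C_bot _ (by linarith)]
        rfl
      · have h'' : 1 ≤ f y := not_lt.1 fun h'' => hy ⟨h', h''⟩
        simp only [g]
        rw [hφ₁ _ (by linarith), cylinderPoint_one h', C_top _ h']
        rfl
  refine ⟨⟨⟨g, hg⟩, ⟨h, hh⟩, ?_, ?_⟩⟩
  · have e₀ : ∀ y, (φ (f y) : ℝ) ≤ 1 / 2 → f y < 1 := fun y hy => by
      linarith [(φ_half _).1 hy]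
    have e₁ : ∀ y, 1 / 2 ≤ (φ (f y) : ℝ) → 0 < f y := fun y hy => by
      by_contra h'
      rw [hφ₀ _ (by linarith)] at hy
      norm_num at hy
    -- Letting `u` run from 0 to 1 switches on the contractions, from the identity to `h ∘ g`.
    refine ContinuousMap.Homotopic.symm ⟨⟨⟨fun z => C z.1 (φ (f z.2), z.2), ?_⟩, ?_, ?_⟩⟩
    · exact hC.comp_continuous (f := fun z : I × K => (z.1, φ (f z.2), z.2))
        (continuous_fst.prodMk ((hφ.comp (hf.comp continuous_snd)).prodMk continuous_snd))
        fun z => ⟨e₀ _, e₁ _⟩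
    · exact fun y => C_zero _ _ (e₀ y) (e₁ y)
    · exact fun y => (g_apply y).symm
  -- With the base point `h p` kept, the height slides from `φ (f (h p))` to `φ (height p)`. The end
  -- map `r` is the reparametrization by `φ`: `h` fixes base points in the middle third, and
  -- elsewhere `φ` already gives a pole.
  · let T : I × Suspension {y : K // 0 < f y ∧ f y < 1} → I := fun z =>
      clamp ((1 - (z.1 : ℝ)) * φ (f (h z.2)) + z.1 * φ (height z.2))
    have hht := continuous_height (X := {y : K // 0 < f y ∧ f y < 1})
    have hT : Continuous T := hclamp.comp (by fun_prop)
    have hF : Continuous fun z => cylinderPoint f (h z.2, T z) := by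
      refine continuous_cylinderPoint hf (hh.comp continuous_snd) hT fun z => ?_
      have hht' : Continuous fun z : I × Suspension {y : K // 0 < f y ∧ f y < 1} =>
        (height z.2 : ℝ) := by fun_prop
      have hfh : Continuous fun z : I × Suspension {y : K // 0 < f y ∧ f y < 1} =>
        f (h z.2) := by fun_prop
      rcases lt_or_ge (height z.2 : ℝ) (1 / 3) with h' | h'
      · rcases lt_or_ge 0 (f (h z.2)) with h'' | h''
        · exact Or.inl ⟨h'', h_lt _ (by linarith)⟩
        · right; left
          filter_upwards [hht'.continuousAt.eventually_lt_const h',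
            hfh.continuousAt.eventually_lt_const (show f (h z.2) < 1 / 3 by linarith)] with w hw hw'
          refine ⟨by linarith, ?_⟩
          simp only [T, hφ₀ _ hw.le, hφ₀ _ hw'.le]
          exact clamp_zero _ (by simp)
      · rcases lt_or_ge (2 / 3) (height z.2 : ℝ) with h₂ | h₂
        · rcases lt_or_ge (f (h z.2)) 1 with h'' | h''
          · exact Or.inl ⟨h_pos _ (by linarith), h''⟩
          · right; right
            filter_upwards [hht'.continuousAt.eventually_const_lt h₂,
              hfh.continuousAt.eventually_const_lt
                (show 2 / 3 < f (h z.2) by linarith)] with w hw hw'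
            refine ⟨by linarith, ?_⟩
            simp only [T, hφ₁ _ hw.le, hφ₁ _ hw'.le]
            exact clamp_one _ (by simp)
        · exact Or.inl (hm _ h' h₂)
    let r : C(Suspension {y : K // 0 < f y ∧ f y < 1}, Suspension {y : K // 0 < f y ∧ f y < 1}) :=
      ⟨fun p => cylinderPoint f (h p, T (1, p)), hF.comp (continuous_const.prodMk continuous_id)⟩
    have hT₁ : ∀ p, T (1, p) = φ (height p) := fun p => by
      simp only [T, Set.Icc.coe_one, sub_self, zero_mul, one_mul, zero_add, clamp_coe]
    have hr : ContinuousMap.Homotopic ((ContinuousMap.mk g hg).comp ⟨h, hh⟩) r := by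
      refine ⟨⟨⟨_, hF⟩, fun p => ?_, fun p => rfl⟩⟩
      change cylinderPoint f (h p, T (0, p)) = cylinderPoint f (h p, φ (f (h p)))
      simp only [T, Set.Icc.coe_zero, sub_zero, zero_mul, one_mul, add_zero, clamp_coe]
    refine hr.trans (homotopic_id_of_reparam ⟨fun t => φ t, by fun_prop⟩ (hφ₀ _ (by simp))
      (hφ₁ _ (by norm_num)) r (fun x t => ?_) fun b => ?_)
    · change cylinderPoint f (h (point x t), T (1, point x t)) = point x (φ t)
      rw [hT₁, height_point]
      rcases lt_or_ge (t : ℝ) (1 / 3) with h' | h'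
      · rw [hφ₀ _ h'.le, point_zero, cylinderPoint_zero (h_lt _ ?_)]
        rw [height_point]
        linarith
      · rcases lt_or_ge (2 / 3) (t : ℝ) with h₂ | h₂
        · rw [hφ₁ _ h₂.le, point_one, cylinderPoint_one (h_pos _ ?_)]
          rw [height_point]
          linarith
        · rw [h_mid x t h' h₂, cylinderPoint_of_mem x.2]
    · change cylinderPoint f (h (pole b), T (1, pole b)) = pole b
      rw [hT₁]
      cases b
      · exact (congrArg _ (congrArg _ (hφ₀ _ (by simp)))).trans (cylinderPoint_zero hp₀)
      · exact (congrArg _ (congrArg _ (hφ₁ _ (by norm_num)))).trans (cylinderPoint_one hp₁)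

end Suspension

/-! ### Continuity and linear homotopies in geometric realizations -/

namespace PreAbstractSimplicialComplex

variable {V : Type u} {K : PreAbstractSimplicialComplex V}

namespace Realization

theorem exists_face (x : K.Realization) : ∃ s ∈ K.faces, x ∈ K.closedSimplex s ∧
    ∑ v ∈ s, x.coord v = 1 := x.2.2

theorem coord_nonneg (x : K.Realization) (v : V) : 0 ≤ x.coord v := x.2.1 v

theorem ext_coord {x y : K.Realization} (h : ∀ v, x.coord v = y.coord v) : x = y :=
  Subtype.ext (funext h)

theorem isOpen_iff (O : Set K.Realization) : IsOpen O ↔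
    ∀ s ∈ K.faces, IsOpen[K.closedSimplexTopology s] ((↑) ⁻¹' O : Set (K.closedSimplex s)) := by
  rw [isOpen_iSup_iff]
  simp only [isOpen_coinduced, Subtype.forall]

theorem continuous_closedSimplex_val {s : Finset V} (hs : s ∈ K.faces) :
    Continuous[K.closedSimplexTopology s, _] ((↑) : K.closedSimplex s → K.Realization) := by
  let _ := K.closedSimplexTopology s
  exact ⟨fun O hO => (isOpen_iff O).1 hO s hs⟩

theorem continuous_coord (v : V) : Continuous fun x : K.Realization => x.coord v := by
  refine ⟨fun O hO => (isOpen_iff _).2 fun s _ => ?_⟩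
  let _ := K.closedSimplexTopology s
  have : Continuous fun x : K.closedSimplex s => x.1.coord v :=
    (continuous_apply v).comp continuous_induced_dom
  exact hO.preimage this

/-- A homotopy from an open subset of `|K|` to `|L|` which carries simplices into simplices is
continuous as soon as its barycentric coordinates are. -/
theorem continuous_of_coord {W : Type*} {L : PreAbstractSimplicialComplex W}
    {U : Set K.Realization} (hU : IsOpen U) (F : I × U → L.Realization)
    (hF : ∀ w, Continuous fun z => (F z).coord w)
    (hs : ∀ s ∈ K.faces, ∃ t ∈ L.faces, ∀ (u : I) (x : U), x.1 ∈ K.closedSimplex s →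
      F (u, x) ∈ L.closedSimplex t) : Continuous F := by
  have hc : ∀ x : U, Continuous fun u => F (u, x) := by
    intro x
    obtain ⟨s, hsK, hxs, -⟩ := x.1.exists_face
    obtain ⟨t, htL, ht⟩ := hs s hsK
    let _ := L.closedSimplexTopology t
    have : Continuous fun u => (⟨F (u, x), ht u x hxs⟩ : L.closedSimplex t) :=
      continuous_induced_rng.2 (continuous_pi fun w => (hF w).comp (by fun_prop))
    exact (continuous_closedSimplex_val htL).comp this
  -- The topology is coherent on `|K|`, not visibly on `I × U`. Moving `I` into the target allows a
  -- test on one closed simplex at a time.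
  let Φ : U → C(I, L.Realization) := fun x => ⟨fun u => F (u, x), hc x⟩
  suffices h : Continuous Φ from
    (ContinuousMap.continuous_uncurry_of_continuous ⟨Φ, h⟩).comp continuous_swap
  refine ⟨fun O hO => ?_⟩
  rw [hU.isOpenEmbedding_subtypeVal.isOpen_iff_image_isOpen, isOpen_iff]
  intro s hsK
  obtain ⟨t, htL, ht⟩ := hs s hsK
  let _ := K.closedSimplexTopology s
  let _ := L.closedSimplexTopology t
  have hι : Continuous ((↑) : L.closedSimplex t → L.Realization) := continuous_closedSimplex_val htL
  have hκ : Continuous ((↑) : K.closedSimplex s → K.Realization) := continuous_closedSimplex_val hsK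
  let S : Set (K.closedSimplex s) := (↑) ⁻¹' U
  have hS : IsOpen S := hU.preimage hκ
  let e : S → U := fun x => ⟨x.1.1, x.2⟩
  have he : Continuous e := Continuous.subtype_mk (hκ.comp continuous_subtype_val) _
  -- Here the target is a single Euclidean simplex, where coordinatewise continuity suffices.
  let Ψ : C(S × I, L.closedSimplex t) := ⟨fun z => ⟨F (z.2, e z.1), ht _ _ z.1.1.2⟩,
    continuous_induced_rng.2 (continuous_pi fun w => (hF w).comp (by fun_prop))⟩
  have h : Continuous fun x : S => (ContinuousMap.mk _ hι).comp (Ψ.curry x) :=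
    (ContinuousMap.continuous_postcomp _).comp Ψ.curry.continuous
  convert hS.isOpenMap_subtype_val _ (hO.preimage h) using 1
  ext x
  constructor
  · rintro ⟨y, hy, hyx⟩
    have hx : x.1 ∈ U := hyx ▸ y.2
    refine ⟨⟨x, hx⟩, ?_, rfl⟩
    have : y = e ⟨x, hx⟩ := Subtype.ext hyx
    rw [this] at hy
    exact hy
  · rintro ⟨y, hy, rfl⟩
    exact ⟨e y, hy, rfl⟩

theorem sum_coord (x : K.Realization) {t : Finset V} (hx : x ∈ K.closedSimplex t) :
    ∑ v ∈ t, x.coord v = 1 := by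
  classical
  obtain ⟨s, -, hs, h⟩ := x.exists_face
  rw [← h, Finset.sum_subset (Finset.subset_union_left (s₂ := s)) fun v _ hv => hx v hv,
    Finset.sum_subset (Finset.subset_union_right (s₁ := t)) fun v _ hv => hs v hv]

/-- The point at parameter `u` of the segment from `x` to `y`, where `x` and `y` lie in a common
closed simplex. -/
def segment (x y : K.Realization)
    (h : ∃ t ∈ K.faces, x ∈ K.closedSimplex t ∧ y ∈ K.closedSimplex t) (u : I) : K.Realization :=
  ⟨fun v => (1 - (u : ℝ)) * x.coord v + u * y.coord v, fun v =>
    add_nonneg (mul_nonneg (sub_nonneg.2 u.2.2) (x.coord_nonneg v))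
      (mul_nonneg u.2.1 (y.coord_nonneg v)), by
    obtain ⟨t, ht, hx, hy⟩ := h
    refine ⟨t, ht, fun v hv => ?_, ?_⟩
    · simp [hx v hv, hy v hv]
    · rw [Finset.sum_add_distrib, ← Finset.mul_sum, ← Finset.mul_sum, x.sum_coord hx, y.sum_coord hy]
      ring⟩

/-- The total weight of a point on a finite set of vertices. -/
def mass (N : Finset V) (x : K.Realization) : ℝ := ∑ v ∈ N, x.coord v

theorem continuous_mass (N : Finset V) : Continuous (mass (K := K) N) :=
  continuous_finsetSum _ fun v _ => continuous_coord v

/-- The vertex `p` of `|K|`. -/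
noncomputable def vertex (p : V) (hp : {p} ∈ K.faces) : K.Realization := by
  classical exact
  ⟨Pi.single p 1, fun v => by by_cases h : v = p <;> simp [h], {p}, hp,
    fun v hv => by simp [Finset.mem_singleton.not.1 hv], by simp⟩

theorem vertex_mem {p : V} {hp : {p} ∈ K.faces} {t : Finset V} (h : p ∈ t) :
    vertex p hp ∈ K.closedSimplex t := by
  classical
  intro v hv
  have : v ≠ p := fun e => hv (e ▸ h)
  simp [vertex, coord, this]

/-- The point which arises from `x` by dropping the coordinates outside of `D` and rescaling. -/
noncomputable def restrict (D : Set V) (x : K.Realization) (m : ℝ) (hm : 0 < m)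
    (h : ∀ s ∈ K.faces, x ∈ K.closedSimplex s → ∑ v ∈ s, D.indicator x.coord v = m) :
    K.Realization :=
  ⟨fun v => D.indicator x.coord v / m,
    fun v => div_nonneg (Set.indicator_nonneg (fun v _ => x.coord_nonneg v) v) hm.le, by
      obtain ⟨s, hs, hxs, -⟩ := x.exists_face
      refine ⟨s, hs, fun v hv => ?_, ?_⟩
      · simp [hxs v hv]
      · rw [← Finset.sum_div, h s hs hxs, div_self hm.ne']⟩

/-! ### Contracting open sets defined by the mass -/

section Contraction

variable {N : Finset V} {J : Set ℝ}

theorem isOpen_mass_mem (hJ : IsOpen J) : IsOpen {x : K.Realization | mass N x ∈ J} :=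
  hJ.preimage (continuous_mass N)

theorem continuous_self_map (hJ : IsOpen J)
    (f : {x : K.Realization | mass N x ∈ J} → {x : K.Realization | mass N x ∈ J})
    (hf : ∀ v, Continuous fun x => (f x).1.coord v)
    (hs : ∀ s ∈ K.faces, ∃ t ∈ K.faces, ∀ x, x.1 ∈ K.closedSimplex s →
      (f x).1 ∈ K.closedSimplex t) : Continuous f := by
  have : Continuous fun z : I × {x : K.Realization | mass N x ∈ J} => (f z.2).1 :=
    continuous_of_coord (isOpen_mass_mem hJ) _ (fun v => (hf v).comp continuous_snd)
      fun s hsK => (hs s hsK).imp fun t ht => ⟨ht.1, fun _ x => ht.2 x⟩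
  exact Continuous.subtype_mk (this.comp (f := fun x => ((0 : I), x)) (by fun_prop)) _

/-- Two self-maps are linearly homotopic if they are contiguous. -/
theorem homotopic_of_contiguous (hJ : IsOpen J) (hJc : Convex ℝ J)
    (f g : C({x : K.Realization | mass N x ∈ J}, {x : K.Realization | mass N x ∈ J}))
    (hs : ∀ s ∈ K.faces, ∃ t ∈ K.faces, ∀ x, x.1 ∈ K.closedSimplex s →
      (f x).1 ∈ K.closedSimplex t ∧ (g x).1 ∈ K.closedSimplex t) : f.Homotopic g := by
  have hseg : ∀ x, ∃ t ∈ K.faces, (f x).1 ∈ K.closedSimplex t ∧ (g x).1 ∈ K.closedSimplex t := by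
    intro x
    obtain ⟨s, hsK, hx, -⟩ := x.1.exists_face
    exact (hs s hsK).imp fun t ht => ⟨ht.1, ht.2 x hx⟩
  let F : I × {x : K.Realization | mass N x ∈ J} → K.Realization :=
    fun z => segment (f z.2).1 (g z.2).1 (hseg z.2) z.1
  have hF : Continuous F := by
    refine continuous_of_coord (isOpen_mass_mem hJ) _ (fun v => ?_) fun s hsK => ?_
    · have h₁ : Continuous fun z : I × {x : K.Realization | mass N x ∈ J} => (f z.2).1.coord v :=
        (continuous_coord v).comp (by fun_prop)
      have h₂ : Continuous fun z : I × {x : K.Realization | mass N x ∈ J} => (g z.2).1.coord v :=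
        (continuous_coord v).comp (by fun_prop)
      change Continuous fun z : I × {x : K.Realization | mass N x ∈ J} =>
        (1 - (z.1 : ℝ)) * (f z.2).1.coord v + z.1 * (g z.2).1.coord v
      fun_prop
    · refine (hs s hsK).imp fun t ht => ⟨ht.1, fun u x hx v hv => ?_⟩
      change (1 - (u : ℝ)) * (f x).1.coord v + u * (g x).1.coord v = 0
      rw [(ht.2 x hx).1 v hv, (ht.2 x hx).2 v hv]
      simp
  -- `mass N` is affine along segments and `J` is convex.
  have hFJ : ∀ z, mass N (F z) ∈ J := by
    intro z
    have : mass N (F z) = (1 - (z.1 : ℝ)) * mass N (f z.2).1 + z.1 * mass N (g z.2).1 := by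
      simp only [mass, Finset.mul_sum, ← Finset.sum_add_distrib]
      rfl
    rw [this]
    exact hJc (f z.2).2 (g z.2).2 (sub_nonneg.2 z.1.2.2) z.1.2.1 (by ring)
  refine ⟨⟨⟨fun z => ⟨F z, hFJ z⟩, by fun_prop⟩, fun x => Subtype.ext (ext_coord fun v => ?_),
    fun x => Subtype.ext (ext_coord fun v => ?_)⟩⟩
  · change (1 - ((0 : I) : ℝ)) * (f x).1.coord v + ((0 : I) : ℝ) * (g x).1.coord v = _
    simp
  · change (1 - ((1 : I) : ℝ)) * (f x).1.coord v + ((1 : I) : ℝ) * (g x).1.coord v = _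
    simp

/-- An open set of points contracts to a vertex `p` if the coordinates outside of `D` can be
dropped and the resulting points lie in common simplices with `p`. -/
theorem contractibleSpace_of_restrict (hJ : IsOpen J) (hJc : Convex ℝ J) (D : Set V)
    (m : K.Realization → ℝ) (hm : Continuous m)
    (hmD : ∀ x, ∀ s ∈ K.faces, x ∈ K.closedSimplex s → ∑ v ∈ s, D.indicator x.coord v = m x)
    (hpos : ∀ x, mass N x ∈ J → 0 < m x)
    (hres : ∀ x, mass N x ∈ J → ∑ v ∈ N, D.indicator x.coord v / m x ∈ J)
    (p : V) (hp : {p} ∈ K.faces) (hpJ : mass N (vertex p hp) ∈ J)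
    (ht : ∀ s ∈ K.faces, ∃ t ∈ K.faces, p ∈ t ∧ ∀ v ∈ s, v ∈ D → v ∈ t) :
    ContractibleSpace {x : K.Realization | mass N x ∈ J} := by
  let r : {x : K.Realization | mass N x ∈ J} → {x : K.Realization | mass N x ∈ J} := fun x =>
    ⟨restrict D x.1 (m x.1) (hpos x.1 x.2) (hmD x.1), hres x.1 x.2⟩
  have hr : ∀ x v, (r x).1.coord v = D.indicator x.1.coord v / m x.1 := fun _ _ => rfl
  have hrs : ∀ (s : Finset V) (x : {x : K.Realization | mass N x ∈ J}),
      x.1 ∈ K.closedSimplex s → (r x).1 ∈ K.closedSimplex s := by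
    intro s x hx v hv
    rw [hr]
    simp [hx v hv]
  have hrc : Continuous r := by
    refine continuous_self_map hJ r (fun v => ?_) fun s hs => ⟨s, hs, hrs s⟩
    simp only [hr]
    refine Continuous.div ?_ (hm.comp continuous_subtype_val) fun x => (hpos x.1 x.2).ne'
    by_cases hv : v ∈ D
    · simp only [Set.indicator_of_mem hv]
      exact (continuous_coord v).comp continuous_subtype_val
    · simp only [Set.indicator_of_notMem hv]
      exact continuous_const
  rw [contractible_iff_id_nullhomotopic]
  -- The identity and `r` are contiguous because `r` preserves every simplex; `r` and the constant
  -- map at `p` are contiguous by `ht`.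
  refine ⟨⟨vertex p hp, hpJ⟩, (homotopic_of_contiguous hJ hJc _ ⟨r, hrc⟩ ?_).trans
    (homotopic_of_contiguous hJ hJc _ _ ?_)⟩
  · exact fun s hs => ⟨s, hs, fun x hx => ⟨hx, hrs s x hx⟩⟩
  · intro s hs
    obtain ⟨t, htK, hpt, hst⟩ := ht s hs
    refine ⟨t, htK, fun x hx => ⟨fun v hv => ?_, vertex_mem (hp := hp) hpt⟩⟩
    change (r x).1.coord v = 0
    rw [hr]
    by_cases hvD : v ∈ D
    · have : v ∉ s := fun hvs => hv (hst v hvs hvD)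
      simp [hx v this]
    · simp [hvD]

end Contraction

end Realization

end PreAbstractSimplicialComplex

/-! ### Independence complexes and the ladder -/

open PreAbstractSimplicialComplex Realization in
/-- If the neighbours of the vertex `a` form a finite nonempty independent set, then the
independence complex is homotopy equivalent to a suspension. -/
theorem SimpleGraph.indComplex_homotopyEquiv_suspension {V : Type u} (G : SimpleGraph V) (a : V)
    (N : Finset V) (hN : ∀ w, G.Adj a w ↔ w ∈ N) (hne : N.Nonempty)
    (hind : G.IsIndepSet (N : Set V)) :
    Nonempty (ContinuousMap.HomotopyEquiv G.indComplex.Realization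
      (Suspension {x : G.indComplex.Realization // 0 < mass N x ∧ mass N x < 1})) := by
  classical
  have hsum : ∀ (x : G.indComplex.Realization), ∀ s ∈ G.indComplex.faces,
      x ∈ G.indComplex.closedSimplex s →
      ∑ v ∈ s, (N : Set V).indicator x.coord v = mass N x := by
    intro x s _ hx
    simp only [Set.indicator_apply, Finset.mem_coe]
    rw [Finset.sum_ite_mem, mass, Finset.inter_comm]
    refine Finset.sum_subset Finset.inter_subset_left fun v hv hv' => hx v fun hvs => hv' ?_
    exact Finset.mem_inter.2 ⟨hv, hvs⟩
  have hsingle : ∀ p : V, {p} ∈ G.indComplex.faces := fun p =>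
    ⟨Finset.singleton_nonempty p, by simp [SimpleGraph.IsIndepSet]⟩
  have hvertex : ∀ p, mass N (vertex p (hsingle p)) = if p ∈ N then 1 else 0 := by
    intro p
    change ∑ v ∈ N, (Pi.single p 1 : V → ℝ) v = _
    exact Finset.sum_pi_single' _ _ _
  have h₀ : ContractibleSpace {x : G.indComplex.Realization | mass N x < 1} := by
    have ha : a ∉ N := fun h => G.irrefl ((hN a).2 h)
    refine contractibleSpace_of_restrict isOpen_Iio (convex_Iio 1) (N : Set V)ᶜ
      (fun x => 1 - mass N x) (continuous_const.sub (continuous_mass N)) ?_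
      (fun x hx => sub_pos.2 hx) ?_ a (hsingle a) ?_ ?_
    · intro x s hs hx
      rw [← hsum x s hs hx, ← x.sum_coord hx, ← Finset.sum_sub_distrib]
      refine Finset.sum_congr rfl fun v _ => ?_
      rw [Set.indicator_compl, Pi.sub_apply]
    · intro x _
      rw [Finset.sum_eq_zero fun v hv => ?_]
      · exact Set.mem_Iio.2 one_pos
      · simp [hv]
    · rw [hvertex, if_neg ha]
      exact Set.mem_Iio.2 one_pos
    · intro s hs
      -- Cone structure: a simplex without its vertices in `N` has no neighbour of `a`, so `a` can
      -- be added.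
      refine ⟨insert a (s \ N), ⟨Finset.insert_nonempty _ _, ?_⟩, Finset.mem_insert_self _ _,
        fun v hv hv' => Finset.mem_insert_of_mem (Finset.mem_sdiff.2 ⟨hv, hv'⟩)⟩
      have hsN : ∀ v ∈ s \ N, ¬ G.Adj a v := fun v hv h => (Finset.mem_sdiff.1 hv).2 ((hN v).1 h)
      rw [Finset.coe_insert]
      refine Set.Pairwise.insert (hs.2.mono (Finset.coe_subset.2 Finset.sdiff_subset)) ?_
      exact fun v hv _ => ⟨hsN v hv, fun h => hsN v hv h.symm⟩
  have h₁ : ContractibleSpace {x : G.indComplex.Realization | 0 < mass N x} := by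
    obtain ⟨p, hp⟩ := hne
    refine contractibleSpace_of_restrict isOpen_Ioi (convex_Ioi 0) (N : Set V)
      (mass N) (continuous_mass N) hsum (fun x hx => hx) ?_ p (hsingle p) ?_ ?_
    · intro x hx
      have : ∑ v ∈ N, (N : Set V).indicator x.coord v / mass N x = 1 := by
        rw [← Finset.sum_div, Finset.sum_congr rfl fun v hv =>
          Set.indicator_of_mem (Finset.mem_coe.2 hv) x.coord]
        exact div_self (ne_of_gt hx)
      rw [this]
      exact Set.mem_Ioi.2 one_pos
    · rw [hvertex, if_pos hp]
      exact Set.mem_Ioi.2 one_pos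
    -- `N` is itself a simplex, and it contains every vertex that is kept.
    · exact fun s _ => ⟨N, ⟨⟨p, hp⟩, hind⟩, hp, fun v _ hv => hv⟩
  exact Suspension.nonempty_homotopyEquiv (continuous_mass N)

/-- The embedding `φ` of graphs exhibits the `2`-ladder as an induced subgraph of `G`; the vertices
`a, b, c, d` of the ladder have no neighbours in `G` outside of it. -/
theorem mainTheorem7 {V : Type u} (G : SimpleGraph V) (φ : twoLadder ↪g G)
    (hφ : ∀ x : LadderVertex,
      x = LadderVertex.a ∨ x = LadderVertex.b ∨ x = LadderVertex.c ∨ x = LadderVertex.d →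
        ∀ w : V, G.Adj (φ x) w → w ∈ Set.range φ) :
    ∃ (X : Type u) (_ : TopologicalSpace X),
      Nonempty (ContinuousMap.HomotopyEquiv G.indComplex.Realization (Suspension X)) := by
  classical
  let N : Finset V := {φ LadderVertex.v1, φ LadderVertex.b, φ LadderVertex.c}
  refine ⟨_, _, G.indComplex_homotopyEquiv_suspension (φ LadderVertex.a) N (fun w => ?_)
    ⟨_, Finset.mem_insert_self _ _⟩ ?_⟩
  · constructor
    · intro h
      obtain ⟨y, rfl⟩ := hφ _ (Or.inl rfl) w h
      rw [φ.map_adj_iff] at h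
      cases y <;> simp [twoLadder, N] at h ⊢
    · intro h
      simp only [N, Finset.mem_insert, Finset.mem_singleton] at h
      rcases h with rfl | rfl | rfl <;> rw [φ.map_adj_iff] <;> simp [twoLadder]
  · intro x hx y hy _
    simp only [N, Finset.coe_insert, Finset.coe_singleton, Set.mem_insert_iff,
      Set.mem_singleton_iff] at hx hy
    rcases hx with rfl | rfl | rfl <;> rcases hy with rfl | rfl | rfl <;>
      rw [φ.map_adj_iff] <;> simp [twoLadder]
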